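/- **Setting.** Let $n\ge 1$ and let $\Theta$ be the set of pairs $\theta=(G,\Sigma)$ of real $n\times n$ matrices such that all eigenvalues of $G$ lie strictly inside the unit circle, $\Sigma$ is symmetric positive definite, and the stationary covariance $C_0$, given by $\operatorname{vec}(C_0)=(I_{n^2}-G\otimes G)^{-1}\operatorname{vec}(\Sigma)$, is a correlation matrix. For $\theta\in\Theta$ let $P_\theta$ be the law of the stationary Gaussian VAR(1) process $z_t=Gz_{t-1}+\varepsilon_t$, $\varepsilon_t\overset{iid}{\sim}N_n(0,\Sigma)$, $t\ge 2$, $z_1\sim N_n(0,C_0)$ independent of $(\varepsilon_t)$. For distribution functions $F_1,\dots,F_n$ on $\mathbb R$ let $H^\infty_{\theta,F_{1:n}}$ be the law of $(y_t)_{t\ge1}$, $y_{t,i}=F_i^{-1}(\Phi(z_{t,i}))$, where $(z_t)\sim P_\theta$, $\Phi$ is the standard normal distribution function and $F_i^{-1}(p)=\inf\{s: p\le F_i(s)\}$. Let $\Pi$ be a prior probability distribution on $\Theta$ having a density $\pi$ with respect to some measure $\nu$ on $\Theta$, with $\pi>0$ $\nu$-almost everywhere. Given $y_{1:T}$, let $$\mathcal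 D(y_{1:T})=\{z_{1:T}: y_{s,i}<y_{t,i}\Rightarrow z_{s,i}<z_{t,i}\ \text{ for all } i\le n,\ s,t\le T\},$$ and let the rank posterior be the conditional law of $(\theta,z_{1:T})$ given the event $z_{1:T}\in\mathcal D(y_{1:T})$ in the model $\theta\sim\Pi$, $z\mid\theta\sim P_\theta$. For a draw $z_{1:T}$ define the margin adjustment $$\tilde F_i(x)=\begin{cases}0,& x<\min_t y_{t,i},\\ 1,& x\ge\max_t y_{t,i},\\ \max\{\Phi(z_{t,i}):t\le T,\ y_{t,i}\le x\},&\text{otherwise,}\end{cases}$$ and let $\tilde\Pi\{\tilde F_i(x)\in A\mid y_{1:T}\}$ be the probability of $\tilde F_i(x)\in A$ when $z_{1:T}$ is drawn from the rank posterior given $y_{1:T}$. **Theorem.** For $\nu$-almost every $\theta_0\in\Theta$ the following holds. Let $F_1,\dots,F_n$ be continuous distribution functions. Then for every $i\in\{1,\dots,n\}$, every $x\in\mathbb R$ and every neighborhood $A$ of $F_i(x)$, $$\lim_{T\to\infty}\tilde\Pi\{\tilde F_i(x)\in A\mid y_{1:T}\}=1\quad\text{a.s. } H^\infty_{\theta_0,F_{1:n}}.$$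 -/

import Mathlib

open MeasureTheory ProbabilityTheory Filter Topology
open scoped ENNReal Kronecker

/-- The stationary covariance matrix `C₀` of the recursion `z_t = G z_{t-1} + ε_t` with
innovation covariance `S`: `vec C₀ = (I - G ⊗ G)⁻¹ vec S` (`vec` stacks columns). -/
noncomputable def stationaryCov {n : ℕ} (G S : Matrix (Fin n) (Fin n) ℝ) :
    Matrix (Fin n) (Fin n) ℝ :=
  Matrix.of fun i j =>
    ((1 - G ⊗ₖ G)⁻¹).mulVec S.vec (j, i)

/-- The parameter space `Θ`: pairs of a transition matrix with all (complex) eigenvalues strictly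
inside the unit circle and a symmetric positive definite innovation covariance, such that the
stationary covariance is a correlation matrix. -/
structure VARParam (n : ℕ) where
  /-- transition matrix -/
  G : Matrix (Fin n) (Fin n) ℝ
  /-- innovation covariance matrix -/
  S : Matrix (Fin n) (Fin n) ℝ
  stable : ∀ z ∈ spectrum ℂ (G.map (fun a : ℝ => (a : ℂ))), ‖z‖ < 1
  posDef : S.PosDef
  corr_posSemidef : (stationaryCov G S).PosSemidef
  corr_diag : ∀ i, stationaryCov G S i i = 1

/-- The Borel structure of `Θ` as a subset of a product of two matrix spaces. -/
instance VARParam.instMeasurableSpace (n : ℕ) : MeasurableSpace (VARParam n) :=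
  MeasurableSpace.comap
    (fun θ : VARParam n => ((θ.G, θ.S) : (Fin n → Fin n → ℝ) × (Fin n → Fin n → ℝ)))
    inferInstance

/-- The trajectory of the recursion with transition matrix `G`: started at `e 0` and driven by
the innovations `e 1, e 2, …`. Time `t : ℕ` here is time `t + 1` in one-based indexing. -/
noncomputable def varPath {n : ℕ} (G : Matrix (Fin n) (Fin n) ℝ)
    (e : ℕ → EuclideanSpace ℝ (Fin n)) : ℕ → EuclideanSpace ℝ (Fin n)
  | 0 => e 0
  | t + 1 => WithLp.toLp 2 (G.mulVec (varPath G e t).ofLp) + e (t + 1)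

/-- The law of the independent driving variables: the starting value is drawn from the stationary
law `N(0, C₀)`, the innovations are iid `N(0, S)`. -/
noncomputable def innovationLaw {n : ℕ} (θ : VARParam n) :
    Measure (ℕ → EuclideanSpace ℝ (Fin n)) :=
  Measure.infinitePi fun t =>
    if t = 0 then multivariateGaussian 0 (stationaryCov θ.G θ.S) else multivariateGaussian 0 θ.S

/-- The law of the stationary Gaussian VAR(1) process `(z_1, z_2, …)` with parameter `θ`. -/
noncomputable def varLaw {n : ℕ} (θ : VARParam n) : Measure (ℕ → EuclideanSpace ℝ (Fin n)) :=
  (innovationLaw θ).map (varPath θ.G)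

section Measurability

variable {n : ℕ}

theorem VARParam.measurable_pair : Measurable
    (fun θ : VARParam n => ((θ.G, θ.S) : (Fin n → Fin n → ℝ) × (Fin n → Fin n → ℝ))) :=
  comap_measurable _

theorem VARParam.measurable_G (i j : Fin n) : Measurable fun θ : VARParam n => θ.G i j :=
  (measurable_pi_apply j).comp ((measurable_pi_apply i).comp
    (measurable_fst.comp VARParam.measurable_pair))

theorem VARParam.measurable_S (i j : Fin n) : Measurable fun θ : VARParam n => θ.S i j :=
  (measurable_pi_apply j).comp ((measurable_pi_apply i).comp
    (measurable_snd.comp VARParam.measurable_pair))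

theorem measurable_inv_entry {α ι : Type*} [MeasurableSpace α] [Fintype ι] [DecidableEq ι]
    (M : α → Matrix ι ι ℝ) (hM : ∀ i j, Measurable fun a => M a i j) (i j : ι) :
    Measurable fun a => (M a)⁻¹ i j := by
  have hdet : ∀ N : α → Matrix ι ι ℝ, (∀ i j, Measurable fun a => N a i j) →
      Measurable fun a => (N a).det := by
    intro N hN
    simp only [Matrix.det_apply]
    refine Finset.measurable_sum _ fun σ _ => ?_
    exact (Finset.measurable_prod _ fun k _ => hN _ _).const_smul _
  simp only [Matrix.inv_def, Matrix.smul_apply, Ring.inverse_eq_inv', smul_eq_mul,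
    Matrix.adjugate_apply]
  refine (hdet M hM).inv.mul (hdet _ fun k l => ?_)
  by_cases hk : k = j
  · simp [Matrix.updateRow_apply, hk]
  · simpa [Matrix.updateRow_apply, hk] using hM k l

theorem measurable_stationaryCov (i j : Fin n) :
    Measurable fun θ : VARParam n => stationaryCov θ.G θ.S i j := by
  simp only [stationaryCov, Matrix.of_apply, Matrix.mulVec, dotProduct, Matrix.vec]
  refine Finset.measurable_sum _ fun k _ => Measurable.mul ?_ (VARParam.measurable_S _ _)
  refine measurable_inv_entry (fun θ : VARParam n => 1 - θ.G ⊗ₖ θ.G) (fun a b => ?_) _ _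
  simp only [Matrix.sub_apply, Matrix.kroneckerMap_apply]
  exact measurable_const.sub ((VARParam.measurable_G _ _).mul (VARParam.measurable_G _ _))

open scoped Matrix.Norms.L2Operator MatrixOrder in
theorem measurable_sqrt_entry {α : Type*} [MeasurableSpace α]
    (M : α → Matrix (Fin n) (Fin n) ℝ) (hM : ∀ i j, Measurable fun a => M a i j)
    (hpos : ∀ a, (M a).PosSemidef) (i j : Fin n) :
    Measurable fun a => (CFC.sqrt (M a)) i j := by
  let : MeasurableSpace (Matrix (Fin n) (Fin n) ℝ) := MeasurableSpace.pi
  have : BorelSpace (Matrix (Fin n) (Fin n) ℝ) :=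
    inferInstanceAs (BorelSpace (Fin n → Fin n → ℝ))
  have h1 : Measurable fun a => (⟨M a, (hpos a).nonneg⟩ :
      {A : Matrix (Fin n) (Fin n) ℝ | 0 ≤ A}) :=
    Measurable.subtype_mk (measurable_pi_iff.2 fun i => measurable_pi_iff.2 fun j => hM i j)
  have h2 : Measurable ({A : Matrix (Fin n) (Fin n) ℝ | 0 ≤ A}.domRestrict CFC.sqrt) :=
    (CFC.continuousOn_sqrt.domRestrict).measurable
  have h3 : Measurable fun A : Matrix (Fin n) (Fin n) ℝ => A i j :=
    (measurable_pi_apply j).comp (measurable_pi_apply i)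
  exact h3.comp (h2.comp h1)

theorem measurable_varPath_prod : Measurable
    fun p : VARParam n × (ℕ → EuclideanSpace ℝ (Fin n)) => varPath p.1.G p.2 := by
  refine measurable_pi_iff.2 fun t => ?_
  induction t with
  | zero => exact (measurable_pi_apply 0).comp measurable_snd
  | succ t ih =>
    simp only [varPath]
    refine Measurable.add ?_ ((measurable_pi_apply _).comp measurable_snd)
    refine (WithLp.measurable_toLp 2 _).comp (measurable_pi_iff.2 fun i => ?_)
    simp only [Matrix.mulVec, dotProduct]
    refine Finset.measurable_sum _ fun k _ => ?_
    refine ((VARParam.measurable_G i k).comp measurable_fst).mul ?_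
    exact (measurable_pi_apply k).comp ((WithLp.measurable_ofLp 2 _).comp ih)

instance (θ : VARParam n) : IsProbabilityMeasure (innovationLaw θ) := by
  have : ∀ t : ℕ, IsProbabilityMeasure (if t = 0 then
      multivariateGaussian 0 (stationaryCov θ.G θ.S) else multivariateGaussian 0 θ.S) := by
    intro t; split_ifs <;> infer_instance
  unfold innovationLaw; infer_instance

open scoped MatrixOrder Matrix.Norms.L2Operator in
/-- The driving variables are a jointly measurable transformation of standard Gaussian noise. -/
theorem exists_innovationLaw_eq_map :
    ∃ f : VARParam n × (ℕ → EuclideanSpace ℝ (Fin n)) → ℕ → EuclideanSpace ℝ (Fin n),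
      Measurable f ∧ ∀ θ : VARParam n, innovationLaw θ = (Measure.infinitePi fun _ : ℕ =>
        stdGaussian (EuclideanSpace ℝ (Fin n))).map (fun e => f (θ, e)) := by
  let R : VARParam n → ℕ → Matrix (Fin n) (Fin n) ℝ := fun θ t =>
    CFC.sqrt (if t = 0 then stationaryCov θ.G θ.S else θ.S)
  have hR : ∀ t i j, Measurable fun θ : VARParam n => R θ t i j := by
    intro t i j
    refine measurable_sqrt_entry
      (fun θ : VARParam n => if t = 0 then stationaryCov θ.G θ.S else θ.S)
      (fun i j => ?_) (fun θ => ?_) i j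
    · by_cases ht : t = 0
      · simpa [ht] using measurable_stationaryCov i j
      · simpa [ht] using VARParam.measurable_S i j
    · by_cases ht : t = 0
      · simpa [ht] using θ.corr_posSemidef
      · simpa [ht] using θ.posDef.posSemidef
  refine ⟨fun p t => Matrix.toEuclideanCLM (𝕜 := ℝ) (R p.1 t) (p.2 t), ?_, fun θ => ?_⟩
  · refine measurable_pi_iff.2 fun t => ?_
    change Measurable fun p : VARParam n × (ℕ → EuclideanSpace ℝ (Fin n)) =>
      WithLp.toLp 2 ((R p.1 t).mulVec (p.2 t).ofLp)
    refine (WithLp.measurable_toLp 2 _).comp (measurable_pi_iff.2 fun i => ?_)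
    simp only [Matrix.mulVec, dotProduct]
    refine Finset.measurable_sum _ fun k _ => ?_
    refine ((hR t i k).comp measurable_fst).mul ?_
    exact (measurable_pi_apply k).comp ((WithLp.measurable_ofLp 2 _).comp
      ((measurable_pi_apply t).comp measurable_snd))
  · have := Measure.infinitePi_map_pi (μ := fun _ : ℕ => stdGaussian (EuclideanSpace ℝ (Fin n)))
      (f := fun t x => Matrix.toEuclideanCLM (𝕜 := ℝ) (R θ t) x)
      (fun t => by fun_prop)
    rw [this, innovationLaw]
    congr 1
    funext t
    by_cases ht : t = 0 <;> simp [ht, R, multivariateGaussian]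

theorem measurable_varPath (θ : VARParam n) : Measurable (varPath θ.G) :=
  measurable_varPath_prod.comp (measurable_prodMk_left (x := θ))

instance (θ : VARParam n) : IsProbabilityMeasure (varLaw θ) :=
  Measure.isProbabilityMeasure_map (measurable_varPath θ).aemeasurable

theorem measurable_varLaw : Measurable (varLaw (n := n)) := by
  obtain ⟨f, hf, hlaw⟩ := exists_innovationLaw_eq_map (n := n)
  have hg : Measurable fun p : VARParam n × (ℕ → EuclideanSpace ℝ (Fin n)) =>
      varPath p.1.G (f p) := measurable_varPath_prod.comp (measurable_fst.prodMk hf)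
  have hfθ : ∀ θ : VARParam n, Measurable fun e => f (θ, e) := fun θ =>
    hf.comp measurable_prodMk_left
  refine Measure.measurable_of_measurable_coe _ fun s hs => ?_
  have h := measurable_measure_prodMk_left (ν := Measure.infinitePi fun _ : ℕ =>
      stdGaussian (EuclideanSpace ℝ (Fin n))) (hg hs)
  convert h using 2 with θ
  rw [varLaw, hlaw, Measure.map_map (measurable_varPath θ) (hfθ θ),
    Measure.map_apply ((measurable_varPath θ).comp (hfθ θ)) hs]
  rfl

end Measurability

/-- The Markov kernel `θ ↦ varLaw θ`. -/
noncomputable def varKernel (n : ℕ) : Kernel (VARParam n) (ℕ → EuclideanSpace ℝ (Fin n)) where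
  toFun := varLaw
  measurable' := measurable_varLaw

instance (n : ℕ) : IsMarkovKernel (varKernel n) :=
  ⟨fun θ => inferInstanceAs (IsProbabilityMeasure (varLaw θ))⟩

/-- The standard normal distribution function `Φ`. -/
noncomputable def stdNormalCDF (z : ℝ) : ℝ := cdf (gaussianReal 0 1) z

/-- `F` is the distribution function of a real random variable. -/
structure IsDistributionFunction (F : ℝ → ℝ) : Prop where
  mono : Monotone F
  right_cont : ∀ x, ContinuousWithinAt F (Set.Ici x) x
  tendsto_atBot : Tendsto F atBot (𝓝 0)
  tendsto_atTop : Tendsto F atTop (𝓝 1)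

/-- The quantile function (generalized inverse) `F⁻¹(p) = inf {s | p ≤ F s}`. -/
noncomputable def quantile (F : ℝ → ℝ) (p : ℝ) : ℝ := sInf {s | p ≤ F s}

/-- The observations `y_{t,i} = F_i⁻¹(Φ(z_{t,i}))`. -/
noncomputable def copulaLink {n : ℕ} (F : Fin n → ℝ → ℝ)
    (z : ℕ → EuclideanSpace ℝ (Fin n)) : ℕ → Fin n → ℝ :=
  fun t i => quantile (F i) (stdNormalCDF (z t i))

/-- `H^∞_{θ,F}`: the joint law of the observed sequence `(y_1, y_2, …)` in the copula model. -/
noncomputable def obsLaw {n : ℕ} (θ : VARParam n) (F : Fin n → ℝ → ℝ) :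
    Measure (ℕ → Fin n → ℝ) :=
  (varLaw θ).map (copulaLink F)

theorem measurable_quantile {F : ℝ → ℝ} (hF : IsDistributionFunction F) :
    Measurable (quantile F) := by
  have h0 : ∀ s, 0 ≤ F s := fun s => hF.mono.le_of_tendsto hF.tendsto_atBot s
  have h1 : ∀ s, F s ≤ 1 := fun s => hF.mono.ge_of_tendsto hF.tendsto_atTop s
  have hmono : MonotoneOn (quantile F) (Set.Ioo 0 1) := by
    intro p hp q hq hpq
    obtain ⟨b, hb⟩ := (hF.tendsto_atBot.eventually (gt_mem_nhds hp.1)).exists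
    obtain ⟨a, ha⟩ := (hF.tendsto_atTop.eventually (lt_mem_nhds hq.2)).exists
    refine csInf_le_csInf ⟨b, fun s hs => ?_⟩ ⟨a, ha.le⟩ fun s hs => le_trans hpq hs
    by_contra hlt
    exact absurd (hF.mono (not_le.1 hlt).le) (not_le.2 (lt_of_lt_of_le hb hs))
  have hle : ∀ p, p ≤ 0 → quantile F p = 0 := by
    intro p hp
    have : {s | p ≤ F s} = Set.univ := Set.eq_univ_of_forall fun s => le_trans hp (h0 s)
    simp [quantile, this]
  have hgt : ∀ p, 1 < p → quantile F p = 0 := by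
    intro p hp
    have : {s | p ≤ F s} = ∅ :=
      Set.eq_empty_of_forall_notMem fun s hs => absurd (le_trans hs (h1 s)) (not_le.2 hp)
    simp [quantile, this]
  have hm : Measurable ((Set.Ioo (0 : ℝ) 1).domRestrict (quantile F)) := by
    refine Monotone.measurable fun a b hab => hmono a.2 b.2 hab
  refine measurable_of_restrict_of_restrict_compl measurableSet_Ioo hm ?_
  have : (Set.Ioo (0 : ℝ) 1)ᶜ.domRestrict (quantile F) =
      fun p : ((Set.Ioo (0 : ℝ) 1)ᶜ : Set ℝ) => if (p : ℝ) = 1 then quantile F 1 else 0 := by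
    funext p
    by_cases hp : (p : ℝ) = 1
    · simp [hp]
    · rcases le_or_gt (p : ℝ) 0 with h | h
      · simp [hp, hle _ h]
      · have : 1 < (p : ℝ) := lt_of_le_of_ne
          (not_lt.1 fun hlt => p.2 ⟨h, hlt⟩) (Ne.symm hp)
        simp [hp, hgt _ this]
  rw [this]
  exact Measurable.ite (measurable_subtype_coe (measurableSet_singleton 1))
    measurable_const measurable_const

theorem measurable_copulaLink {n : ℕ} {F : Fin n → ℝ → ℝ}
    (hF : ∀ i, IsDistributionFunction (F i)) : Measurable (copulaLink F) := by
  refine measurable_pi_iff.2 fun t => measurable_pi_iff.2 fun i => ?_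
  refine (measurable_quantile (hF i)).comp ((monotone_cdf _).measurable.comp ?_)
  exact (measurable_pi_apply i).comp ((WithLp.measurable_ofLp 2 _).comp (measurable_pi_apply t))

/-- The rank event `z_{1:T} ∈ D(y_{1:T})`: in every series the first `T` latent values obey the
partial ordering of the first `T` observations. -/
def rankEvent {n : ℕ} (T : ℕ) (y : ℕ → Fin n → ℝ) : Set (ℕ → EuclideanSpace ℝ (Fin n)) :=
  {z | ∀ i, ∀ s < T, ∀ t < T, y s i < y t i → z s i < z t i}

/-- The rank posterior: the conditional law of `(θ, z)`, under the prior `P` on `θ` and the VAR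
model for `z` given `θ`, given the event `z_{1:T} ∈ D(y_{1:T})`. -/
noncomputable def rankPosterior {n : ℕ} (P : Measure (VARParam n)) (T : ℕ)
    (y : ℕ → Fin n → ℝ) : Measure (VARParam n × (ℕ → EuclideanSpace ℝ (Fin n))) :=
  cond (P ⊗ₘ varKernel n) {p | p.2 ∈ rankEvent T y}

open Classical in
/-- The margin adjustment `F̃(x)` built from observations `y_{1:T}` and latent values `z_{1:T}` of
one series: `0` for `x < min y`, `1` for `x ≥ max y`, and `max {Φ(z_t) : y_t ≤ x}` otherwise. -/
noncomputable def marginAdjustment (T : ℕ) (y z : ℕ → ℝ) (x : ℝ) : ℝ :=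
  if ∀ t < T, x < y t then 0
  else if ∀ t < T, y t ≤ x then 1
  else sSup {u | ∃ t < T, y t ≤ x ∧ u = stdNormalCDF (z t)}

/-- The probability of `F̃_i(x) ∈ A` under the pseudo-posterior given `y_{1:T}`, that is, when
`F̃_i` is computed from `y_{1:T}` and a draw of `z_{1:T}` from the rank posterior. -/
noncomputable def marginPosterior {n : ℕ} (P : Measure (VARParam n)) (T : ℕ)
    (y : ℕ → Fin n → ℝ) (i : Fin n) (x : ℝ) (A : Set ℝ) : ℝ≥0∞ :=
  rankPosterior P T y
    {p | marginAdjustment T (fun t => y t i) (fun t => p.2 t i) x ∈ A}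

/-!
The margins are continuous, so `z ↦ F_i⁻¹(Φ(z))` is strictly increasing and the observations carry
exactly the rank information of the latent path. The rank posterior given `y_{1:T}` is therefore
the conditional law of `(θ, z)` given the ordering of the first `T` latent values in each series,
in the Bayesian model `θ ~ P`, `z | θ ~ varLaw θ`.

Two facts then give the result.

* *The ranks determine the path.* In every stationary stable VAR(1) process the empirical
  distribution function of each series converges almost surely to `Φ`
  (`ae_tendsto_fractionBelow`). Hence the relative rank of `z_{t,i}` among the first `T` values
  converges to `Φ(z_{t,i})`, and `Φ(z_{t,i})` is almost surely measurable with respect to the ranks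
  of the whole path. The law of large numbers behind this is obtained from second moments: writing
  `z_{s+k} = G^k z_s + W` with `W` independent of `z_s`, the covariance of `f(z_{s,i})` and
  `f(z_{s+k,i})` for bounded Lipschitz `f` is at most a constant times the entries of `G^k`, which
  are summable by Gelfand's formula (`VARParam.summable_pow_entry`). Convergence along the averages
  over `m ^ 2` terms is all that is needed.
* *Doob's argument.* By Lévy's upward theorem the posterior probability of `{Φ(z_{t,i}) > q}`
  converges to the indicator of this event at the true path, for all `t`, `i` and rational `q`
  simultaneously, almost surely in the joint model (`ae_tendsto_rankPosterior`). By disintegration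
  this holds `varLaw θ₀`-almost surely for `P`-almost every, equivalently `ν`-almost every, `θ₀`.
  The exceptional set of `θ₀` does not involve the margins.

The remaining step is deterministic (`tendsto_marginPosterior`). The values `z_{t,i}` are dense, so
there are times `t₁`, `t₂` with `y_{t₁,i} ≤ x < y_{t₂,i}` and with `Φ(z_{t₁,i})`, `Φ(z_{t₂,i})`
close to `F_i(x)`. On the rank event the margin adjustment at `x` computed from a draw `z'` lies
between `Φ(z'_{t₁,i})` and `Φ(z'_{t₂,i})`, and these two concentrate at the true values.
-/

/-! ### Powers of the transition matrix and the Lyapunov equation -/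

section
open scoped Matrix.Norms.Operator
/-- By Gelfand's formula the powers of a complex matrix with spectrum in the open unit disc decay
geometrically. -/
theorem summable_norm_pow_of_spectrum {n : ℕ} [NeZero n] (A : Matrix (Fin n) (Fin n) ℂ)
    (hA : ∀ z ∈ spectrum ℂ A, ‖z‖ < 1) : Summable fun k : ℕ => ‖A ^ k‖ := by
  have : CompleteSpace (Matrix (Fin n) (Fin n) ℂ) := FiniteDimensional.complete ℂ _
  have hr : spectralRadius ℂ A < (1 : NNReal) :=
    spectrum.spectralRadius_lt_of_forall_lt A fun z hz => hA z hz
  obtain ⟨r, hr1, hr2⟩ := ENNReal.lt_iff_exists_nnreal_btwn.1 hr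
  have hev := (spectrum.pow_nnnorm_pow_one_div_tendsto_nhds_spectralRadius A).eventually
    (gt_mem_nhds hr1)
  have hr2' : (r : ℝ) < 1 := by exact_mod_cast hr2
  refine Summable.of_norm_bounded_eventually_nat
    (summable_geometric_of_lt_one r.2 hr2') ?_
  filter_upwards [hev, eventually_gt_atTop 0] with k hk hk0
  have h1 : (‖A ^ k‖₊ : ℝ≥0∞) ≤ (r : ℝ≥0∞) ^ k := by
    have := pow_le_pow_left' hk.le k
    rwa [← ENNReal.rpow_natCast, ← ENNReal.rpow_mul, one_div,
      inv_mul_cancel₀ (by positivity), ENNReal.rpow_one] at this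
  rw [norm_norm]
  exact_mod_cast h1

theorem VARParam.summable_pow_entry {n : ℕ} (θ : VARParam n) (i j : Fin n) :
    Summable fun k : ℕ => |(θ.G ^ k) i j| := by
  have : NeZero n := ⟨fun h => by subst h; exact i.elim0⟩
  refine (summable_norm_pow_of_spectrum _ θ.stable).of_nonneg_of_le (fun _ => abs_nonneg _)
    fun k => ?_
  have h : ‖(θ.G.map (fun a : ℝ => (a : ℂ)) ^ k) i j‖ = |(θ.G ^ k) i j| := by
    have : θ.G.map (fun a : ℝ => (a : ℂ)) ^ k = (θ.G ^ k).map (fun a : ℝ => (a : ℂ)) :=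
      (Matrix.map_pow θ.G Complex.ofRealHom k).symm
    rw [this]; simp
  rw [← h]
  have := Matrix.linfty_opNNNorm_def (θ.G.map (fun a : ℝ => (a : ℂ)) ^ k)
  rw [← coe_nnnorm, ← coe_nnnorm, NNReal.coe_le_coe, this]
  exact (Finset.single_le_sum (f := fun j => ‖(θ.G.map (fun a : ℝ => (a : ℂ)) ^ k) i j‖₊)
    (fun _ _ => zero_le) (Finset.mem_univ j)).trans
    (Finset.le_sup (f := fun i => ∑ j, ‖(θ.G.map (fun a : ℝ => (a : ℂ)) ^ k) i j‖₊)
      (Finset.mem_univ i))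
end

theorem VARParam.tendsto_pow {n : ℕ} (θ : VARParam n) :
    Tendsto (fun k : ℕ => θ.G ^ k) atTop (𝓝 0) :=
  tendsto_pi_nhds.2 fun i => tendsto_pi_nhds.2 fun j =>
    (tendsto_zero_iff_abs_tendsto_zero _).2 (θ.summable_pow_entry i j).tendsto_atTop_zero

/-- The discrete Lyapunov equation. Stability makes `1 - G ⊗ G` invertible, so the inverse in
`stationaryCov` takes no junk value: a fixed point of `X ↦ G X Gᵀ` equals `G^k X (G^k)ᵀ` for all
`k`, hence vanishes. -/
theorem VARParam.stationaryCov_eq {n : ℕ} (θ : VARParam n) :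
    stationaryCov θ.G θ.S = θ.G * stationaryCov θ.G θ.S * θ.G.transpose + θ.S := by
  have hinj : ∀ X : Matrix (Fin n) (Fin n) ℝ, θ.G * X * θ.G.transpose = X → X = 0 := by
    intro X hX
    have hk : ∀ k : ℕ, θ.G ^ k * X * (θ.G ^ k).transpose = X := by
      intro k
      induction k with
      | zero => simp
      | succ k ih =>
        rw [pow_succ, Matrix.transpose_mul]
        calc θ.G ^ k * θ.G * X * (θ.G.transpose * (θ.G ^ k).transpose)
            = θ.G ^ k * (θ.G * X * θ.G.transpose) * (θ.G ^ k).transpose := by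
              simp only [Matrix.mul_assoc]
          _ = X := by rw [hX, ih]
    have hlim : Tendsto (fun k : ℕ => θ.G ^ k * X * (θ.G ^ k).transpose) atTop
        (𝓝 (0 * X * (0 : Matrix (Fin n) (Fin n) ℝ).transpose)) := by
      have hc : Continuous fun M : Matrix (Fin n) (Fin n) ℝ => M * X * M.transpose := by
        fun_prop
      exact (hc.tendsto 0).comp θ.tendsto_pow
    simp only [hk, zero_mul] at hlim
    exact tendsto_nhds_unique tendsto_const_nhds hlim
  have hvec : ∀ X : Matrix (Fin n) (Fin n) ℝ,
      (1 - θ.G ⊗ₖ θ.G).mulVec X.vec = (X - θ.G * X * θ.G.transpose).vec := by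
    intro X
    rw [Matrix.sub_mulVec, Matrix.one_mulVec, Matrix.kronecker_mulVec_vec, Matrix.vec_sub]
  have hunit : IsUnit (1 - θ.G ⊗ₖ θ.G) := by
    rw [← Matrix.mulVec_injective_iff_isUnit]
    refine (injective_iff_map_eq_zero (Matrix.mulVecLin (1 - θ.G ⊗ₖ θ.G))).2 fun v hv => ?_
    obtain ⟨X, rfl⟩ : ∃ X : Matrix (Fin n) (Fin n) ℝ, X.vec = v :=
      ⟨Matrix.of fun i j => v (j, i), rfl⟩
    rw [Matrix.mulVecLin_apply, hvec, Matrix.vec_eq_zero_iff, sub_eq_zero] at hv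
    rw [hinj X hv.symm, Matrix.vec_zero]
  have hdef : (stationaryCov θ.G θ.S).vec = (1 - θ.G ⊗ₖ θ.G)⁻¹.mulVec θ.S.vec := rfl
  have h := hvec (stationaryCov θ.G θ.S)
  rw [hdef, Matrix.mulVec_mulVec, Matrix.mul_nonsing_inv _ ((Matrix.isUnit_iff_isUnit_det _).1 hunit),
    Matrix.one_mulVec, Matrix.vec_inj] at h
  exact sub_eq_iff_eq_add'.1 h.symm

/-! ### Independence and stationarity of the VAR(1) process -/

/-- Functions of disjoint finite sets of coordinates are independent under a product measure. -/
theorem indepFun_infinitePi_of_dependsOn {ι E β γ : Type*} [MeasurableSpace E] [Nonempty E]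
    [MeasurableSpace β] [MeasurableSpace γ] (μ : ι → Measure E)
    [∀ t, IsProbabilityMeasure (μ t)] {f : (ι → E) → β} {g : (ι → E) → γ}
    (hf : Measurable f) (hg : Measurable g) {S T : Finset ι} (hST : Disjoint S T)
    (hfS : DependsOn f (S : Set ι)) (hgT : DependsOn g (T : Set ι)) :
    IndepFun f g (Measure.infinitePi μ) := by
  classical
  obtain ⟨e₀⟩ := ‹Nonempty E›
  let ext : ∀ S : Finset ι, (S → E) → ι → E := fun S u t => if h : t ∈ S then u ⟨t, h⟩ else e₀
  have hext : ∀ S, Measurable (ext S) := by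
    intro S
    refine measurable_pi_iff.2 fun t => ?_
    by_cases h : t ∈ S
    · simpa [ext, h] using measurable_pi_apply _
    · simp [ext, h]
  have hcoord : iIndepFun (fun (t : ι) (e : ι → E) => e t) (Measure.infinitePi μ) :=
    iIndepFun_infinitePi (X := fun _ x => x) fun _ => measurable_id
  have h := (hcoord.indepFun_finset S T hST fun t => measurable_pi_apply t).comp
    (hf.comp (hext S)) (hg.comp (hext T))
  have hf' : (f ∘ ext S) ∘ (fun (e : ι → E) (i : S) => e i) = f := by
    funext e
    exact hfS fun t ht => by simp [ext, Finset.mem_coe.1 ht]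
  have hg' : (g ∘ ext T) ∘ (fun (e : ι → E) (i : T) => e i) = g := by
    funext e
    exact hgT fun t ht => by simp [ext, Finset.mem_coe.1 ht]
  rwa [hf', hg'] at h

section VARProcess

variable {n : ℕ}

theorem dependsOn_varPath (G : Matrix (Fin n) (Fin n) ℝ) (t : ℕ) :
    DependsOn (fun e : ℕ → EuclideanSpace ℝ (Fin n) => varPath G e t)
      (Finset.range (t + 1) : Set ℕ) := by
  intro e e' h
  induction t with
  | zero => exact h 0 (by simp)
  | succ t ih =>
    have h1 := ih fun i hi => h i (by simp at hi ⊢; omega)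
    have h2 := h (t + 1) (by simp)
    simp only at h1
    simp only [varPath, h1, h2]

theorem measurable_varPath_apply (θ : VARParam n) (t : ℕ) :
    Measurable fun e => varPath θ.G e t :=
  (measurable_pi_apply t).comp (measurable_varPath θ)

/-- The contribution of the innovations at the times `s + 1, …, s + k` to the state at time
`s + k`. -/
noncomputable def innovationPart (G : Matrix (Fin n) (Fin n) ℝ) (s k : ℕ)
    (e : ℕ → EuclideanSpace ℝ (Fin n)) : EuclideanSpace ℝ (Fin n) :=
  varPath G (fun t => if t = 0 then 0 else e (s + t)) k

theorem varPath_add (G : Matrix (Fin n) (Fin n) ℝ) (e : ℕ → EuclideanSpace ℝ (Fin n))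
    (s k : ℕ) : varPath G e (s + k) =
      WithLp.toLp 2 ((G ^ k).mulVec (varPath G e s).ofLp) + innovationPart G s k e := by
  induction k with
  | zero => simp [innovationPart, varPath]
  | succ k ih =>
    have h1 : innovationPart G s (k + 1) e =
        WithLp.toLp 2 (G.mulVec (innovationPart G s k e).ofLp) + e (s + (k + 1)) := by
      simp [innovationPart, varPath]
    rw [← add_assoc, varPath, ih, h1]
    simp only [WithLp.ofLp_add, Matrix.mulVec_add, Matrix.mulVec_mulVec, ← pow_succ',
      WithLp.toLp_add, add_assoc]

theorem measurable_innovationPart (θ : VARParam n) (s k : ℕ) :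
    Measurable (innovationPart θ.G s k) := by
  refine (measurable_varPath_apply θ k).comp (measurable_pi_iff.2 fun t => ?_)
  by_cases h : t = 0
  · simp [h]
  · simpa [h] using measurable_pi_apply (s + t)

theorem dependsOn_innovationPart (G : Matrix (Fin n) (Fin n) ℝ) (s k : ℕ) :
    DependsOn (innovationPart G s k) (Finset.Ioc s (s + k) : Set ℕ) := by
  intro e e' h
  refine dependsOn_varPath G k fun t ht => ?_
  by_cases h0 : t = 0
  · simp [h0]
  · simp only [h0, if_false]
    exact h _ (by simp at ht ⊢; omega)

theorem indepFun_varPath_innovationPart (θ : VARParam n) (s k : ℕ) :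
    IndepFun (fun e => varPath θ.G e s) (innovationPart θ.G s k) (innovationLaw θ) := by
  have : ∀ t : ℕ, IsProbabilityMeasure (if t = 0 then
      multivariateGaussian 0 (stationaryCov θ.G θ.S) else multivariateGaussian 0 θ.S) := by
    intro t; split_ifs <;> infer_instance
  refine indepFun_infinitePi_of_dependsOn _ (measurable_varPath_apply θ s)
    (measurable_innovationPart θ s k) ?_ (dependsOn_varPath θ.G s)
    (dependsOn_innovationPart θ.G s k)
  rw [Finset.disjoint_left]
  intro t; simp; omega

theorem innovationPart_one (G : Matrix (Fin n) (Fin n) ℝ) (s : ℕ)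
    (e : ℕ → EuclideanSpace ℝ (Fin n)) : innovationPart G s 1 e = e (s + 1) := by
  simp [innovationPart, varPath]

theorem map_innovationLaw_eval (θ : VARParam n) (t : ℕ) :
    (innovationLaw θ).map (fun e => e t) = if t = 0 then
      multivariateGaussian 0 (stationaryCov θ.G θ.S) else multivariateGaussian 0 θ.S := by
  have : ∀ t : ℕ, IsProbabilityMeasure (if t = 0 then
      multivariateGaussian 0 (stationaryCov θ.G θ.S) else multivariateGaussian 0 θ.S) := by
    intro t; split_ifs <;> infer_instance
  exact Measure.infinitePi_map_eval _ t

/-- Stationarity: every state has law `N(0, C₀)`. -/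
theorem map_varPath_apply (θ : VARParam n) (t : ℕ) :
    (innovationLaw θ).map (fun e => varPath θ.G e t) =
      multivariateGaussian 0 (stationaryCov θ.G θ.S) := by
  induction t with
  | zero => simpa [varPath] using map_innovationLaw_eval θ 0
  | succ t ih =>
    have hL : Measurable fun z : EuclideanSpace ℝ (Fin n) =>
        (WithLp.toLp 2 (θ.G.mulVec z.ofLp) : EuclideanSpace ℝ (Fin n)) := by fun_prop
    have hind := (indepFun_varPath_innovationPart θ t 1).comp hL measurable_id
    have hsum : (fun e => varPath θ.G e (t + 1)) =
        (fun e => (WithLp.toLp 2 (θ.G.mulVec (varPath θ.G e t).ofLp) : EuclideanSpace ℝ (Fin n)))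
          + innovationPart θ.G t 1 := by
      funext e
      simpa using varPath_add θ.G e t 1
    have hone : innovationPart θ.G t 1 = fun e => e (t + 1) := funext (innovationPart_one θ.G t)
    refine Measure.ext_of_charFun (funext fun x => ?_)
    rw [hsum]
    have := hind.charFun_map_add_eq_mul (hL.comp (measurable_varPath_apply θ t)).aemeasurable
      (measurable_innovationPart θ t 1).aemeasurable
    have := congrFun this x
    simp only [Function.comp_def, Pi.mul_apply] at this
    refine this.trans ?_
    rw [hone, map_innovationLaw_eval, if_neg (Nat.succ_ne_zero t),
      ← Function.comp_def (fun z : EuclideanSpace ℝ (Fin n) =>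
        (WithLp.toLp 2 (θ.G.mulVec z.ofLp) : EuclideanSpace ℝ (Fin n))),
      ← Measure.map_map hL (measurable_varPath_apply θ t), ih]
    have hmap : charFun ((multivariateGaussian 0 (stationaryCov θ.G θ.S)).map
        fun z : EuclideanSpace ℝ (Fin n) =>
          (WithLp.toLp 2 (θ.G.mulVec z.ofLp) : EuclideanSpace ℝ (Fin n))) x =
        charFun (multivariateGaussian 0 (stationaryCov θ.G θ.S))
          (WithLp.toLp 2 (θ.G.transpose.mulVec x.ofLp)) := by
      rw [charFun_apply, charFun_apply, integral_map hL.aemeasurable (by fun_prop)]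
      congr with z
      congr 3
      simp only [EuclideanSpace.inner_eq_star_dotProduct, star_trivial]
      rw [Matrix.dotProduct_mulVec, Matrix.mulVec_transpose]
    rw [hmap, charFun_multivariateGaussian θ.corr_posSemidef,
      charFun_multivariateGaussian θ.posDef.posSemidef,
      charFun_multivariateGaussian θ.corr_posSemidef, ← Complex.exp_add]
    congr 1
    have hq : x.ofLp ⬝ᵥ (stationaryCov θ.G θ.S).mulVec x.ofLp =
        (θ.G.transpose.mulVec x.ofLp) ⬝ᵥ
          (stationaryCov θ.G θ.S).mulVec (θ.G.transpose.mulVec x.ofLp) +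
        x.ofLp ⬝ᵥ θ.S.mulVec x.ofLp := by
      conv_lhs => rw [θ.stationaryCov_eq]
      rw [Matrix.add_mulVec, dotProduct_add, Matrix.mul_assoc, ← Matrix.mulVec_mulVec,
        Matrix.dotProduct_mulVec, Matrix.mulVec_transpose, ← Matrix.mulVec_mulVec,
        Matrix.mulVec_transpose]
    rw [hq]
    simp
    ring

theorem map_varPath_coord (θ : VARParam n) (t : ℕ) (i : Fin n) :
    (innovationLaw θ).map (fun e => varPath θ.G e t i) = gaussianReal 0 1 := by
  have h := (measurePreserving_eval_multivariateGaussian (μ := 0) θ.corr_posSemidef (i := i)).map_eq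
  rw [← map_varPath_apply θ t, Measure.map_map (by fun_prop) (measurable_varPath_apply θ t)] at h
  simpa [Function.comp_def, θ.corr_diag] using h

/-- Almost surely no series takes the same value twice: the last innovation `e_{s+k+1,i}` is
independent of the past and has an atomless law because `S` is positive definite. -/
theorem ae_varPath_ne (θ : VARParam n) (s k : ℕ) (i : Fin n) :
    ∀ᵐ e ∂innovationLaw θ, varPath θ.G e s i ≠ varPath θ.G e (s + (k + 1)) i := by
  have hX : Measurable fun e => varPath θ.G e s i - θ.G.mulVec (varPath θ.G e (s + k)).ofLp i := by
    have h1 := measurable_varPath_apply θ s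
    have h2 := measurable_varPath_apply θ (s + k)
    simp only [Matrix.mulVec, dotProduct]
    fun_prop
  have hY : Measurable fun e : ℕ → EuclideanSpace ℝ (Fin n) => e (s + k + 1) i := by fun_prop
  have hind : IndepFun
      (fun e => varPath θ.G e s i - θ.G.mulVec (varPath θ.G e (s + k)).ofLp i)
      (fun e : ℕ → EuclideanSpace ℝ (Fin n) => e (s + k + 1) i) (innovationLaw θ) := by
    have : ∀ t : ℕ, IsProbabilityMeasure (if t = 0 then
        multivariateGaussian 0 (stationaryCov θ.G θ.S) else multivariateGaussian 0 θ.S) := by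
      intro t; split_ifs <;> infer_instance
    refine indepFun_infinitePi_of_dependsOn _ hX hY (S := Finset.range (s + k + 1))
      (T := {s + k + 1}) (by simp) (fun e e' h => ?_) (fun e e' h => ?_)
    · have h1 := dependsOn_varPath θ.G s fun t ht => h t (by simp at ht ⊢; omega)
      have h2 := dependsOn_varPath θ.G (s + k) h
      simp only at h1 h2
      simp only [h1, h2]
    · simp only [h (s + k + 1) (by simp)]
  have hlaw : (innovationLaw θ).map (fun e => e (s + k + 1) i) =
      gaussianReal 0 (θ.S i i).toNNReal := by
    have h := (measurePreserving_eval_multivariateGaussian (μ := 0) θ.posDef.posSemidef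
      (i := i)).map_eq
    have h1 := map_innovationLaw_eval θ (s + k + 1)
    rw [if_neg (Nat.succ_ne_zero _)] at h1
    rw [← h1, Measure.map_map (by fun_prop) (by fun_prop)] at h
    simpa [Function.comp_def] using h
  have hno : NullSingletonClass (gaussianReal 0 (θ.S i i).toNNReal) :=
    nullSingletonClass_gaussianReal (by simpa using θ.posDef.diag_pos)
  have hmeas : MeasurableSet {p : ℝ × ℝ | p.1 ≠ p.2} :=
    (measurableSet_eq_fun measurable_fst measurable_snd).compl
  have hprod := hind.map_prod_eq_prod_map_map hX.aemeasurable hY.aemeasurable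
  have hae : ∀ᵐ p ∂(innovationLaw θ).map (fun e =>
      (varPath θ.G e s i - θ.G.mulVec (varPath θ.G e (s + k)).ofLp i,
        e (s + k + 1) i)), p.1 ≠ p.2 := by
    rw [hprod, hlaw, Measure.ae_prod_iff_ae_ae hmeas]
    refine ae_of_all _ fun x => ?_
    simp [ae_iff]
  filter_upwards [ae_of_ae_map (hX.prodMk hY).aemeasurable hae] with e he heq
  refine he ?_
  rw [heq, ← add_assoc, varPath]
  simp

end VARProcess

/-! ### A law of large numbers from summable covariances -/

theorem ae_tendsto_zero_of_summable_integral {Ω : Type*} [MeasurableSpace Ω] {μ : Measure Ω}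
    {X : ℕ → Ω → ℝ} (hX : ∀ m, Integrable (X m) μ) (h0 : ∀ m ω, 0 ≤ X m ω) {b : ℕ → ℝ}
    (hb : Summable b) (hXb : ∀ m, ∫ ω, X m ω ∂μ ≤ b m) :
    ∀ᵐ ω ∂μ, Tendsto (fun m => X m ω) atTop (𝓝 0) := by
  have hb' : ∀ m, ∫⁻ ω, ENNReal.ofReal (X m ω) ∂μ ≤ ENNReal.ofReal (b m) := fun m => by
    rw [← ofReal_integral_eq_lintegral_ofReal (hX m) (ae_of_all _ (h0 m))]
    exact ENNReal.ofReal_le_ofReal (hXb m)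
  have hmeas : ∀ m, AEMeasurable (fun ω => ENNReal.ofReal (X m ω)) μ := fun m =>
    (hX m).aemeasurable.ennreal_ofReal
  have hfin : ∫⁻ ω, ∑' m, ENNReal.ofReal (X m ω) ∂μ ≠ ∞ := by
    rw [lintegral_tsum hmeas]
    exact ne_top_of_le_ne_top hb.tsum_ofReal_ne_top (ENNReal.tsum_le_tsum hb')
  filter_upwards [ae_lt_top' (AEMeasurable.tsum hmeas) hfin] with ω hω
  have h := (ENNReal.tendsto_toReal ENNReal.zero_ne_top).comp
    (ENNReal.tendsto_atTop_zero_of_tsum_ne_top hω.ne)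
  simpa [Function.comp_def, ENNReal.toReal_ofReal (h0 _ ω)] using h

/-- Bounded variables whose autocovariances are dominated by a summable function of the lag have
averages over `m ^ 2` terms tending to zero almost surely: the second moment of such an average is
`O(1 / m ^ 2)`. -/
theorem ae_tendsto_average_sq_of_summable_cov {Ω : Type*} [MeasurableSpace Ω] {μ : Measure Ω}
    [IsProbabilityMeasure μ] {X : ℕ → Ω → ℝ} (hX : ∀ s, Measurable (X s)) {B : ℝ}
    (hB : ∀ s ω, |X s ω| ≤ B) {c : ℕ → ℝ} (hc : Summable c)
    (hcov : ∀ s k, |∫ ω, X s ω * X (s + k) ω ∂μ| ≤ c k) :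
    ∀ᵐ ω ∂μ, Tendsto (fun m : ℕ => (∑ s ∈ Finset.range (m ^ 2), X s ω) / (m : ℝ) ^ 2) atTop
      (𝓝 0) := by
  have hint : ∀ s t, Integrable (fun ω => X s ω * X t ω) μ := fun s t =>
    Integrable.of_bound ((hX s).mul (hX t)).aestronglyMeasurable (B * B) (ae_of_all _ fun ω => by
      rw [Real.norm_eq_abs, abs_mul]
      exact mul_le_mul (hB s ω) (hB t ω) (abs_nonneg _) ((abs_nonneg _).trans (hB s ω)))
  -- The lag `t - s` takes both signs, so the row sums are compared with a sum over `ℤ`.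
  have hh : Summable fun z : ℤ => c z.natAbs := by
    refine Summable.of_nat_of_neg ?_ ?_ <;> simpa using hc
  have hc0 : ∀ k, 0 ≤ c k := fun k => (abs_nonneg _).trans (hcov 0 k)
  set K := ∑' z : ℤ, c z.natAbs with hK
  have hK0 : 0 ≤ K := tsum_nonneg fun z => hc0 _
  have hrow : ∀ N s : ℕ, ∑ t ∈ Finset.range N, ∫ ω, X s ω * X t ω ∂μ ≤ K := by
    intro N s
    have hinj : Function.Injective fun t : ℕ => (t : ℤ) - s := fun a b h => by simpa using h
    calc ∑ t ∈ Finset.range N, ∫ ω, X s ω * X t ω ∂μ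
        ≤ ∑ t ∈ Finset.range N, c ((t : ℤ) - s).natAbs := by
          refine Finset.sum_le_sum fun t _ => (le_abs_self _).trans ?_
          rcases le_total s t with h | h
          · obtain ⟨k, rfl⟩ := Nat.exists_eq_add_of_le h
            simpa using hcov s k
          · obtain ⟨k, rfl⟩ := Nat.exists_eq_add_of_le h
            simpa [mul_comm] using hcov t k
      _ ≤ ∑' t : ℕ, c ((t : ℤ) - s).natAbs :=
          (hh.comp_injective hinj).sum_le_tsum _ fun t _ => hc0 _
      _ ≤ K := tsum_comp_le_tsum_of_inj hh (fun z => hc0 _) hinj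
  have hsq : ∀ N : ℕ, Integrable (fun ω => (∑ s ∈ Finset.range N, X s ω) ^ 2) μ ∧
      ∫ ω, (∑ s ∈ Finset.range N, X s ω) ^ 2 ∂μ ≤ N * K := by
    intro N
    simp only [sq, Finset.sum_mul_sum]
    refine ⟨integrable_finsetSum _ fun s _ => integrable_finsetSum _ fun t _ => hint s t, ?_⟩
    rw [integral_finsetSum _ fun s _ => integrable_finsetSum _ fun t _ => hint s t]
    simp only [integral_finsetSum _ fun t _ => hint _ t]
    calc _ ≤ ∑ s ∈ Finset.range N, K := Finset.sum_le_sum fun s _ => hrow N s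
      _ = N * K := by simp
  have hlim := ae_tendsto_zero_of_summable_integral (μ := μ)
    (X := fun m ω => ((∑ s ∈ Finset.range (m ^ 2), X s ω) / (m : ℝ) ^ 2) ^ 2)
    (b := fun m => K * (1 / (m : ℝ) ^ 2)) (fun m => by
      simp only [div_pow]; exact (hsq _).1.div_const _) (fun m ω => sq_nonneg _)
    ((Real.summable_one_div_nat_pow.2 one_lt_two).mul_left K) (fun m => by
      simp only [div_pow]
      rw [integral_div]
      rcases Nat.eq_zero_or_pos m with rfl | hm
      · simp
      · have := (hsq (m ^ 2)).2
        have hm' : (0 : ℝ) < m := by exact_mod_cast hm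
        rw [div_le_iff₀ (by positivity)]
        refine this.trans (le_of_eq ?_)
        push_cast
        field_simp)
  filter_upwards [hlim] with ω hω
  have := hω.sqrt
  simp only [Real.sqrt_zero, Real.sqrt_sq_eq_abs] at this
  exact (tendsto_zero_iff_abs_tendsto_zero _).2 this

section VARProcess

variable {n : ℕ}

/-- Decay of covariances. Replacing `z_{s+k,i}` by its part independent of `z_s` changes a Lipschitz
function by at most `K |(G^k z_s)_i|`, and makes the covariance vanish. -/
theorem abs_integral_centered_mul_le (θ : VARParam n) (i : Fin n) {f : ℝ → ℝ} {K : NNReal}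
    (hf : LipschitzWith K f) (hf1 : ∀ x, |f x| ≤ 1) (s k : ℕ) :
    |∫ e, (f (varPath θ.G e s i) - ∫ x, f x ∂gaussianReal 0 1) *
        (f (varPath θ.G e (s + k) i) - ∫ x, f x ∂gaussianReal 0 1) ∂innovationLaw θ| ≤
      ∑ j, 2 * K * (∫ x, |x| ∂gaussianReal 0 1) * |(θ.G ^ k) i j| := by
  set m := ∫ x, f x ∂gaussianReal 0 1 with hm
  have hfm : Measurable f := hf.continuous.measurable
  have hm1 : |m| ≤ 1 := by
    have := norm_integral_le_of_norm_le_const (μ := gaussianReal 0 1)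
      (ae_of_all _ fun x => (Real.norm_eq_abs (f x)).trans_le (hf1 x))
    simpa using this
  have hZ : ∀ t (j : Fin n), Measurable fun e => varPath θ.G e t j := fun t j => by
    have := measurable_varPath_apply θ t; fun_prop
  have hW : Measurable fun e => innovationPart θ.G s k e i := by
    have := measurable_innovationPart θ s k; fun_prop
  have hb : ∀ x, |f x - m| ≤ 2 := fun x => (abs_sub _ _).trans (by linarith [hf1 x])
  have hcoord : ∀ j, Integrable (fun e => |varPath θ.G e s j|) (innovationLaw θ) ∧
      ∫ e, |varPath θ.G e s j| ∂innovationLaw θ = ∫ x, |x| ∂gaussianReal 0 1 := by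
    intro j
    have hi : Integrable (fun x : ℝ => |x|) (gaussianReal 0 1) :=
      (IsGaussian.integrable_id (μ := gaussianReal 0 1)).abs
    rw [← map_varPath_coord θ s j] at hi ⊢
    exact ⟨hi.comp_measurable (hZ s j), (integral_map (hZ s j).aemeasurable
      hi.aestronglyMeasurable).symm⟩
  have hmean : ∫ e, (f (varPath θ.G e s i) - m) ∂innovationLaw θ = 0 := by
    have h1 : ∫ e, f (varPath θ.G e s i) ∂innovationLaw θ = m := by
      rw [hm, ← map_varPath_coord θ s i, integral_map (hZ s i).aemeasurable
        hfm.aestronglyMeasurable]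
    have h2 : Integrable (fun e => f (varPath θ.G e s i)) (innovationLaw θ) :=
      Integrable.of_bound (hfm.comp (hZ s i)).aestronglyMeasurable 1 (ae_of_all _ fun e => hf1 _)
    rw [integral_sub h2 (integrable_const _), h1]; simp
  have hind : IndepFun (fun e => f (varPath θ.G e s i) - m)
      (fun e => f (innovationPart θ.G s k e i) - m) (innovationLaw θ) :=
    (indepFun_varPath_innovationPart θ s k).comp
      (φ := fun z : EuclideanSpace ℝ (Fin n) => f (z i) - m)
      (ψ := fun z : EuclideanSpace ℝ (Fin n) => f (z i) - m) (by fun_prop) (by fun_prop)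
  have hzero : ∫ e, (f (varPath θ.G e s i) - m) * (f (innovationPart θ.G s k e i) - m)
      ∂innovationLaw θ = 0 := by
    rw [hind.integral_fun_mul_eq_mul_integral
      ((hfm.comp (hZ s i)).sub_const m).aestronglyMeasurable
      ((hfm.comp hW).sub_const m).aestronglyMeasurable, hmean, zero_mul]
  have hbi : ∀ g h : (ℕ → EuclideanSpace ℝ (Fin n)) → ℝ, Measurable g → Measurable h →
      Integrable (fun e => (f (g e) - m) * (f (h e) - m)) (innovationLaw θ) := by
    intro g h hg hh
    refine Integrable.of_bound (by fun_prop) (2 * 2) (ae_of_all _ fun e => ?_)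
    rw [Real.norm_eq_abs, abs_mul]
    exact mul_le_mul (hb _) (hb _) (abs_nonneg _) zero_le_two
  have hdiff : ∫ e, (f (varPath θ.G e s i) - m) * (f (varPath θ.G e (s + k) i) - m)
        ∂innovationLaw θ =
      ∫ e, ((f (varPath θ.G e s i) - m) * (f (varPath θ.G e (s + k) i) - m) -
        (f (varPath θ.G e s i) - m) * (f (innovationPart θ.G s k e i) - m)) ∂innovationLaw θ := by
    rw [integral_sub (hbi _ _ (hZ s i) (hZ _ i)) (hbi _ _ (hZ s i) hW), hzero, sub_zero]
  rw [hdiff]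
  have hpt : ∀ e, ‖(f (varPath θ.G e s i) - m) * (f (varPath θ.G e (s + k) i) - m) -
        (f (varPath θ.G e s i) - m) * (f (innovationPart θ.G s k e i) - m)‖ ≤
      ∑ j, 2 * K * |(θ.G ^ k) i j| * |varPath θ.G e s j| := by
    intro e
    have h1 : varPath θ.G e (s + k) i - innovationPart θ.G s k e i =
        ∑ j, (θ.G ^ k) i j * varPath θ.G e s j := by
      rw [varPath_add]; simp [Matrix.mulVec, dotProduct]
    have h2 := hf.dist_le_mul (varPath θ.G e (s + k) i) (innovationPart θ.G s k e i)
    rw [Real.dist_eq, Real.dist_eq, h1] at h2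
    have h3 : |∑ j, (θ.G ^ k) i j * varPath θ.G e s j| ≤
        ∑ j, |(θ.G ^ k) i j| * |varPath θ.G e s j| := by
      refine (Finset.abs_sum_le_sum_abs _ _).trans (le_of_eq ?_)
      simp [abs_mul]
    rw [← mul_sub, sub_sub_sub_cancel_right, Real.norm_eq_abs, abs_mul]
    calc _ ≤ 2 * (K * ∑ j, |(θ.G ^ k) i j| * |varPath θ.G e s j|) :=
          mul_le_mul (hb _) (h2.trans (mul_le_mul_of_nonneg_left h3 K.2)) (abs_nonneg _)
            zero_le_two
      _ = _ := by simp only [Finset.mul_sum]; exact Finset.sum_congr rfl fun j _ => by ring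
  refine (norm_integral_le_of_norm_le (integrable_finsetSum _ fun j _ =>
    (hcoord j).1.const_mul _) (ae_of_all _ hpt)).trans (le_of_eq ?_)
  rw [integral_finsetSum _ fun j _ => (hcoord j).1.const_mul _]
  refine Finset.sum_congr rfl fun j _ => ?_
  rw [integral_const_mul, (hcoord j).2]
  ring

/-- Law of large numbers for bounded Lipschitz functions of a series, along the averages over
`m ^ 2` terms. -/
theorem ae_tendsto_average_sq (θ : VARParam n) (i : Fin n) {f : ℝ → ℝ} {K : NNReal}
    (hf : LipschitzWith K f) (hf1 : ∀ x, |f x| ≤ 1) :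
    ∀ᵐ z ∂varLaw θ, Tendsto
      (fun m : ℕ => (∑ s ∈ Finset.range (m ^ 2), f (z s i)) / (m : ℝ) ^ 2) atTop
      (𝓝 (∫ x, f x ∂gaussianReal 0 1)) := by
  have hfm : Measurable f := hf.continuous.measurable
  rw [varLaw, ae_map_iff (measurable_varPath θ).aemeasurable
    (measurableSet_tendsto _ fun m => by fun_prop)]
  set μ := ∫ x, f x ∂gaussianReal 0 1 with hμ
  have hμ1 : |μ| ≤ 1 := by
    have := norm_integral_le_of_norm_le_const (μ := gaussianReal 0 1)
      (ae_of_all _ fun x => (Real.norm_eq_abs (f x)).trans_le (hf1 x))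
    simpa using this
  have hc : Summable fun k => ∑ j, 2 * K * (∫ x, |x| ∂gaussianReal 0 1) * |(θ.G ^ k) i j| :=
    summable_sum fun j _ => (θ.summable_pow_entry i j).mul_left _
  filter_upwards [ae_tendsto_average_sq_of_summable_cov (μ := innovationLaw θ)
    (X := fun s e => f (varPath θ.G e s i) - μ) (B := 2) (fun s => by
      have := measurable_varPath_apply θ s; fun_prop)
    (fun s e => (abs_sub _ _).trans (by linarith [hf1 (varPath θ.G e s i)])) hc
    (abs_integral_centered_mul_le θ i hf hf1)] with e he
  have := he.add_const μ
  rw [zero_add] at this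
  refine this.congr' ?_
  filter_upwards [eventually_gt_atTop 0] with m hm
  have hm' : (m : ℝ) ≠ 0 := by positivity
  rw [Finset.sum_sub_distrib]
  simp
  field_simp
  ring

end VARProcess

/-! ### The standard normal distribution function -/

theorem stdNormalCDF_eq (x : ℝ) : stdNormalCDF x = (gaussianReal 0 1).real (Set.Iic x) :=
  cdf_eq_real _ x

theorem strictMono_stdNormalCDF : StrictMono stdNormalCDF := by
  intro a b hab
  have hpos : 0 < (gaussianReal 0 1).real (Set.Ioc a b) := by
    refine ENNReal.toReal_pos (fun h => ?_) (measure_ne_top _ _)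
    have := gaussianReal_absolutelyContinuous' 0 one_ne_zero h
    rw [Real.volume_Ioc, ENNReal.ofReal_eq_zero] at this
    linarith
  have h := measureReal_union (μ := gaussianReal 0 1) (Set.Iic_disjoint_Ioc (a := a) (b := a)
    (c := b) le_rfl) measurableSet_Ioc
  rw [Set.Iic_union_Ioc_eq_Iic hab.le] at h
  rw [stdNormalCDF_eq, stdNormalCDF_eq, h]
  linarith

theorem continuous_stdNormalCDF : Continuous stdNormalCDF := by
  have hno : NullSingletonClass (gaussianReal 0 1) := nullSingletonClass_gaussianReal one_ne_zero
  refine continuous_iff_continuousAt.2 fun x => ?_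
  have h := (cdf (gaussianReal 0 1)).measure_singleton x
  rw [measure_cdf, measure_singleton, eq_comm, ENNReal.ofReal_eq_zero] at h
  refine (monotone_cdf (gaussianReal 0 1)).continuousAt_iff_leftLim_eq_rightLim.2 ?_
  rw [StieltjesFunction.rightLim_eq]
  exact le_antisymm ((monotone_cdf _).leftLim_le le_rfl) (by linarith)

theorem stdNormalCDF_pos (x : ℝ) : 0 < stdNormalCDF x :=
  (cdf_nonneg (gaussianReal 0 1) (x - 1)).trans_lt (strictMono_stdNormalCDF (sub_one_lt x))

theorem stdNormalCDF_lt_one (x : ℝ) : stdNormalCDF x < 1 :=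
  (strictMono_stdNormalCDF (lt_add_one x)).trans_le (cdf_le_one (gaussianReal 0 1) (x + 1))

theorem exists_stdNormalCDF_eq {u : ℝ} (h0 : 0 < u) (h1 : u < 1) : ∃ x, stdNormalCDF x = u := by
  obtain ⟨a, ha⟩ := ((tendsto_cdf_atBot (gaussianReal 0 1)).eventually (gt_mem_nhds h0)).exists
  obtain ⟨b, hb⟩ := ((tendsto_cdf_atTop (gaussianReal 0 1)).eventually (lt_mem_nhds h1)).exists
  exact mem_range_of_exists_le_of_exists_ge continuous_stdNormalCDF ⟨a, ha.le⟩ ⟨b, hb.le⟩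

/-! ### Convergence of empirical distribution functions -/

/-- For `a < b`, the piecewise linear function equal to `1` on `(-∞, a]` and to `0` on `[b, ∞)`. -/
noncomputable def ramp (a b x : ℝ) : ℝ := max 0 (min 1 ((b - x) / (b - a)))

theorem exists_lipschitzWith_ramp {a b : ℝ} (hab : a < b) :
    ∃ K : NNReal, LipschitzWith K (ramp a b) := by
  have h1 : 0 < b - a := sub_pos.2 hab
  have h : LipschitzWith (1 / (b - a)).toNNReal fun x : ℝ => (b - x) / (b - a) := by
    refine LipschitzWith.of_dist_le_mul fun x y => le_of_eq ?_
    rw [Real.dist_eq, Real.dist_eq, ← sub_div, sub_sub_sub_cancel_left, abs_div, abs_of_pos h1,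
      abs_sub_comm, Real.coe_toNNReal _ (by positivity)]
    ring
  exact ⟨_, (h.const_min 1).const_max 0⟩

theorem ramp_nonneg (a b x : ℝ) : 0 ≤ ramp a b x := le_max_left _ _

theorem ramp_le_one (a b x : ℝ) : ramp a b x ≤ 1 := max_le zero_le_one (min_le_left _ _)

theorem ramp_eq_one {a b x : ℝ} (hab : a < b) (hx : x ≤ a) : ramp a b x = 1 := by
  have h1 : 1 ≤ (b - x) / (b - a) := (one_le_div (sub_pos.2 hab)).2 (by linarith)
  simp [ramp, h1]

theorem ramp_eq_zero {a b x : ℝ} (hab : a < b) (hx : b ≤ x) : ramp a b x = 0 := by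
  have h1 : (b - x) / (b - a) ≤ 0 :=
    div_nonpos_of_nonpos_of_nonneg (by linarith) (sub_pos.2 hab).le
  exact max_eq_left ((min_le_right _ _).trans h1)

theorem integral_ramp_mem {a b : ℝ} (hab : a < b) :
    ∫ x, ramp a b x ∂gaussianReal 0 1 ∈ Set.Icc (stdNormalCDF a) (stdNormalCDF b) := by
  obtain ⟨K, hK⟩ := exists_lipschitzWith_ramp hab
  have hi : Integrable (ramp a b) (gaussianReal 0 1) :=
    Integrable.of_bound hK.continuous.aestronglyMeasurable 1 (ae_of_all _ fun x => by
      rw [Real.norm_eq_abs, abs_of_nonneg (ramp_nonneg a b x)]; exact ramp_le_one a b x)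
  have hind : ∀ c, Integrable ((Set.Iic c).indicator fun _ => (1 : ℝ)) (gaussianReal 0 1) :=
    fun c => (integrable_const 1).indicator measurableSet_Iic
  have hval : ∀ c, ∫ x, (Set.Iic c).indicator (fun _ => (1 : ℝ)) x ∂gaussianReal 0 1 =
      stdNormalCDF c := fun c => by
    rw [integral_indicator_const _ measurableSet_Iic, stdNormalCDF_eq]; simp
  rw [← hval a, ← hval b]
  refine ⟨integral_mono (hind a) hi fun x => ?_, integral_mono hi (hind b) fun x => ?_⟩
  · by_cases h : x ≤ a
    · simp [h, ramp_eq_one hab h]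
    · simp [h, ramp_nonneg]
  · by_cases h : x ≤ b
    · simp [h, ramp_le_one]
    · simp [h, ramp_eq_zero hab (not_le.1 h).le]

open Classical in
/-- The proportion of the first `m ^ 2` terms of `w` that are less than `x`. The time horizon
`m ^ 2` is the one along which averages are known to converge. -/
noncomputable def fractionBelow (w : ℕ → ℝ) (x : ℝ) (m : ℕ) : ℝ :=
  (∑ s ∈ Finset.range (m ^ 2), if w s < x then 1 else 0) / (m : ℝ) ^ 2

/-- Convergence of the averages of ramps with rational endpoints implies convergence of the empirical
distribution functions at every real point, in particular at a term of the sequence itself. -/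
theorem tendsto_fractionBelow {w : ℕ → ℝ}
    (hw : ∀ a b : ℚ, a < b → Tendsto
      (fun m : ℕ => (∑ s ∈ Finset.range (m ^ 2), ramp a b (w s)) / (m : ℝ) ^ 2) atTop
      (𝓝 (∫ x, ramp a b x ∂gaussianReal 0 1))) (x : ℝ) :
    Tendsto (fractionBelow w x) atTop (𝓝 (stdNormalCDF x)) := by
  refine tendsto_order.2 ⟨fun c hc => ?_, fun c hc => ?_⟩
  · have hev := continuous_stdNormalCDF.continuousAt.eventually (lt_mem_nhds hc)
    obtain ⟨l, hl, hl'⟩ := exists_Ioc_subset_of_mem_nhds hev (exists_lt x)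
    obtain ⟨a, ha1, ha2⟩ := exists_rat_btwn hl
    obtain ⟨b, hb1, hb2⟩ := exists_rat_btwn ha2
    have hca : c < stdNormalCDF a := hl' ⟨ha1, ha2.le⟩
    filter_upwards [(hw a b (by exact_mod_cast hb1)).eventually
      (lt_mem_nhds (hca.trans_le (integral_ramp_mem hb1).1))] with m hm
    refine hm.trans_le (div_le_div_of_nonneg_right (Finset.sum_le_sum fun s _ => ?_) (by positivity))
    split_ifs with h
    · exact ramp_le_one _ _ _
    · exact (ramp_eq_zero hb1 (hb2.le.trans (not_lt.1 h))).le
  · have hev := continuous_stdNormalCDF.continuousAt.eventually (gt_mem_nhds hc)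
    obtain ⟨r, hr, hr'⟩ := exists_Ico_subset_of_mem_nhds hev (exists_gt x)
    obtain ⟨b, hb1, hb2⟩ := exists_rat_btwn hr
    obtain ⟨a, ha1, ha2⟩ := exists_rat_btwn hb1
    have hca : stdNormalCDF b < c := hr' ⟨hb1.le, hb2⟩
    filter_upwards [(hw a b (by exact_mod_cast ha2)).eventually
      (gt_mem_nhds ((integral_ramp_mem ha2).2.trans_lt hca))] with m hm
    refine (div_le_div_of_nonneg_right (Finset.sum_le_sum fun s _ => ?_) (by positivity)).trans_lt hm
    split_ifs with h
    · exact (ramp_eq_one ha2 (h.trans ha1).le).ge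
    · exact ramp_nonneg _ _ _

theorem exists_mem_Ioo_of_tendsto_fractionBelow {w : ℕ → ℝ}
    (hw : ∀ x, Tendsto (fractionBelow w x) atTop (𝓝 (stdNormalCDF x))) {a b : ℝ} (hab : a < b) :
    ∃ s, w s ∈ Set.Ioo a b := by
  obtain ⟨c, hac, hcb⟩ := exists_between hab
  by_contra! h
  have heq : fractionBelow w c = fractionBelow w b := by
    funext m
    have : ∀ s, w s < c ↔ w s < b := fun s =>
      ⟨fun h1 => h1.trans hcb, fun h1 => by
        by_contra h2
        exact h s ⟨hac.trans_le (not_lt.1 h2), h1⟩⟩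
    simp only [fractionBelow, this]
  have h1 := hw c
  rw [heq] at h1
  exact (strictMono_stdNormalCDF hcb).ne (tendsto_nhds_unique h1 (hw b))

theorem ae_tendsto_fractionBelow {n : ℕ} (θ : VARParam n) :
    ∀ᵐ z ∂varLaw θ, ∀ (i : Fin n) (x : ℝ),
      Tendsto (fractionBelow (fun s => z s i) x) atTop (𝓝 (stdNormalCDF x)) := by
  have h : ∀ᵐ z ∂varLaw θ, ∀ (i : Fin n) (a b : ℚ), a < b → Tendsto
      (fun m : ℕ => (∑ s ∈ Finset.range (m ^ 2), ramp a b (z s i)) / (m : ℝ) ^ 2) atTop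
      (𝓝 (∫ x, ramp a b x ∂gaussianReal 0 1)) := by
    refine ae_all_iff.2 fun i => ae_all_iff.2 fun a => ae_all_iff.2 fun b => ?_
    by_cases hab : a < b
    · obtain ⟨K, hK⟩ := exists_lipschitzWith_ramp (a := a) (b := b) (by exact_mod_cast hab)
      filter_upwards [ae_tendsto_average_sq θ i hK fun x => by
        rw [abs_of_nonneg (ramp_nonneg _ _ _)]; exact ramp_le_one _ _ _] with z hz _ using hz
    · exact ae_of_all _ fun z hab' => absurd hab' hab
  filter_upwards [h] with z hz i x using tendsto_fractionBelow (hz i) x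

theorem ae_ne_of_ne {n : ℕ} (θ : VARParam n) :
    ∀ᵐ z ∂varLaw θ, ∀ (i : Fin n) (s t : ℕ), s ≠ t → z s i ≠ z t i := by
  have h : ∀ᵐ z ∂varLaw θ, ∀ (i : Fin n) (s k : ℕ), z s i ≠ z (s + (k + 1)) i := by
    refine ae_all_iff.2 fun i => ae_all_iff.2 fun s => ae_all_iff.2 fun k => ?_
    have hm : MeasurableSet {z : ℕ → EuclideanSpace ℝ (Fin n) | z s i ≠ z (s + (k + 1)) i} :=
      (measurableSet_eq_fun (by fun_prop) (by fun_prop)).compl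
    rw [varLaw, ae_map_iff (measurable_varPath θ).aemeasurable hm]
    exact ae_varPath_ne θ s k i
  filter_upwards [h] with z hz i s t hst
  rcases lt_or_gt_of_ne hst with hlt | hlt
  · obtain ⟨k, rfl⟩ := Nat.exists_eq_add_of_lt hlt
    exact hz i s k
  · obtain ⟨k, rfl⟩ := Nat.exists_eq_add_of_lt hlt
    exact (hz i t k).symm

/-! ### The rank posterior as a conditional expectation -/

/-- For a finitely valued `X`, conditioning on `σ(X)` is elementary conditioning on the level sets
of `X`. -/
theorem condExp_indicator_comap_of_finite {Ω α : Type*} [MeasurableSpace Ω] {μ : Measure Ω}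
    [IsFiniteMeasure μ] [Finite α] [mα : MeasurableSpace α] [MeasurableSingletonClass α]
    {X : Ω → α} (hX : Measurable X) {B : Set Ω} (hB : MeasurableSet B) :
    (fun ω => (μ[|X ⁻¹' {X ω}]).real B) =ᵐ[μ] μ[B.indicator (fun _ => (1 : ℝ)) | mα.comap X] := by
  have hg : Measurable[mα.comap X] fun ω => (μ[|X ⁻¹' {X ω}]).real B :=
    (measurable_of_finite fun a => (μ[|X ⁻¹' {a}]).real B).comp (comap_measurable X)
  have hgi : Integrable (fun ω => (μ[|X ⁻¹' {X ω}]).real B) μ :=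
    Integrable.of_bound (hg.mono hX.comap_le le_rfl).aestronglyMeasurable 1 (ae_of_all _ fun ω => by
      rw [Real.norm_eq_abs, abs_of_nonneg measureReal_nonneg]
      exact measureReal_le_one)
  refine ae_eq_condExp_of_forall_setIntegral_eq hX.comap_le
    ((integrable_const 1).indicator hB) (fun s _ _ => hgi.integrableOn) ?_
    hg.stronglyMeasurable.aestronglyMeasurable
  rintro _ ⟨S, hS, rfl⟩ -
  have hfin := Set.toFinite S
  have hU : X ⁻¹' S = ⋃ a ∈ hfin.toFinset, X ⁻¹' {a} := by
    ext ω; simp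
  have hmeas : ∀ a, MeasurableSet (X ⁻¹' {a}) := fun a => hX (measurableSet_singleton a)
  have hdisj : (hfin.toFinset : Set α).PairwiseDisjoint fun a => X ⁻¹' {a} := fun a _ b _ hab =>
    Disjoint.preimage X (by simpa using hab)
  rw [hU, integral_biUnion_finset _ (fun a _ => hmeas a) hdisj fun a _ => hgi.integrableOn,
    integral_biUnion_finset _ (fun a _ => hmeas a) hdisj
      fun a _ => ((integrable_const 1).indicator hB).integrableOn]
  refine Finset.sum_congr rfl fun a _ => ?_
  rw [setIntegral_congr_fun (g := fun _ => (μ[|X ⁻¹' {a}]).real B) (hmeas a)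
    fun ω hω => by simp only [Set.mem_preimage, Set.mem_singleton_iff] at hω; simp only [hω],
    setIntegral_const, setIntegral_indicator hB, setIntegral_const, smul_eq_mul, smul_eq_mul,
    mul_one, Measure.real, Measure.real, Measure.real, ← ENNReal.toReal_mul, mul_comm,
    cond_mul_eq_inter (hmeas a)]

section Posterior

variable {n : ℕ}

/-- The rank information in the first `T` latent values: the strict order relation among them, in
each series. -/
def rankPattern (T : ℕ) (z : ℕ → EuclideanSpace ℝ (Fin n)) : Fin n → Fin T → Fin T → Prop :=
  fun i s t => z s i < z t i

theorem measurable_rankPattern (T : ℕ) : Measurable (rankPattern (n := n) T) := by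
  refine measurable_pi_iff.2 fun i => measurable_pi_iff.2 fun s => measurable_pi_iff.2 fun t => ?_
  exact measurableSet_setOfPred.1 (measurableSet_lt (by fun_prop) (by fun_prop))

/-- The filtration generated by the ranks of the first `T` latent values, on the space of pairs
`(θ, z)`. -/
def rankFiltration (n : ℕ) : Filtration ℕ
    (inferInstance : MeasurableSpace (VARParam n × (ℕ → EuclideanSpace ℝ (Fin n)))) where
  seq T := MeasurableSpace.comap (fun p => rankPattern T p.2) inferInstance
  mono' := by
    intro T T' hT
    have : (fun p : VARParam n × (ℕ → EuclideanSpace ℝ (Fin n)) => rankPattern T p.2) =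
        (fun (r : Fin n → Fin T' → Fin T' → Prop) i s t => r i (Fin.castLE hT s)
          (Fin.castLE hT t)) ∘ fun p => rankPattern T' p.2 := rfl
    simp only
    rw [this, ← MeasurableSpace.comap_comp]
    exact MeasurableSpace.comap_mono (Measurable.of_discrete).comap_le
  le' T := ((measurable_rankPattern T).comp measurable_snd).comap_le

theorem measurableSet_rankFiltration_lt {s t T : ℕ} (hs : s < T) (ht : t < T) (i : Fin n) :
    MeasurableSet[rankFiltration n T]
      {p : VARParam n × (ℕ → EuclideanSpace ℝ (Fin n)) | p.2 s i < p.2 t i} :=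
  ⟨{r | r i ⟨s, hs⟩ ⟨t, ht⟩}, MeasurableSet.of_discrete, rfl⟩

/-- In the absence of ties, obeying the strict order of `z` determines the rank pattern, so that the
rank event is a level set of `rankPattern`. -/
theorem rankEvent_eq_preimage {T : ℕ} {z : ℕ → EuclideanSpace ℝ (Fin n)}
    (hz : ∀ (i : Fin n) (s t : ℕ), s ≠ t → z s i ≠ z t i) :
    rankEvent T (fun t i => z t i) = rankPattern T ⁻¹' {rankPattern T z} := by
  ext z'
  simp only [rankEvent, Set.mem_ofPred_eq, Set.mem_preimage, Set.mem_singleton_iff]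
  constructor
  · intro h
    funext i s t
    refine propext ⟨fun hlt => ?_, h i s s.2 t t.2⟩
    by_contra hle
    have hst : (s : ℕ) ≠ t := fun hst => by
      simp [rankPattern, hst] at hlt
    exact hlt.not_gt (h i t t.2 s s.2 (lt_of_le_of_ne (not_lt.1 hle) (hz i t s hst.symm)))
  · intro h i s hs t ht hlt
    have := congrFun (congrFun (congrFun h i) ⟨s, hs⟩) ⟨t, ht⟩
    simp only [rankPattern] at this
    rwa [this]

theorem measurable_stdNormalCDF_coord (t : ℕ) (i : Fin n) :
    Measurable fun p : VARParam n × (ℕ → EuclideanSpace ℝ (Fin n)) => stdNormalCDF (p.2 t i) :=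
  continuous_stdNormalCDF.measurable.comp (by fun_prop)

/-- Doob's consistency argument: almost surely in the joint model, the rank posterior probability
of each event `{q < Φ(z_{t,i})}` converges to its indicator at the true path. -/
theorem ae_tendsto_rankPosterior (P : Measure (VARParam n)) [IsProbabilityMeasure P] :
    ∀ᵐ p ∂(P ⊗ₘ varKernel n), ∀ (t : ℕ) (i : Fin n) (q : ℚ),
      Tendsto (fun T => rankPosterior P T (fun t i => p.2 t i)
          {p' | (q : ℝ) < stdNormalCDF (p'.2 t i)}) atTop
        (𝓝 ({p' : VARParam n × (ℕ → EuclideanSpace ℝ (Fin n)) |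
          (q : ℝ) < stdNormalCDF (p'.2 t i)}.indicator 1 p)) := by
  set μ := P ⊗ₘ varKernel n with hμ
  have hmf : ∀ m (t : ℕ) (i : Fin n), Measurable[⨆ T, rankFiltration n T]
      fun p : VARParam n × (ℕ → EuclideanSpace ℝ (Fin n)) =>
        fractionBelow (fun s => p.2 s i) (p.2 t i) m := by
    intro m t i
    unfold fractionBelow
    refine Measurable.div_const (Finset.measurable_sum _ fun s _ => ?_) _
    refine Measurable.ite ?_ measurable_const measurable_const
    exact le_iSup (rankFiltration n) (max s t + 1) _
      (measurableSet_rankFiltration_lt (by omega) (by omega) i)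
  have hle : ⨆ T, rankFiltration n T ≤ (inferInstance : MeasurableSpace _) :=
    iSup_le (rankFiltration n).le
  have hfrac : ∀ᵐ p ∂μ, ∀ (i : Fin n) (t : ℕ),
      Tendsto (fractionBelow (fun s => p.2 s i) (p.2 t i)) atTop
        (𝓝 (stdNormalCDF (p.2 t i))) := by
    refine ae_all_iff.2 fun i => ae_all_iff.2 fun t => ?_
    refine (Measure.ae_compProd_iff ?_).2 (ae_of_all _ fun θ => ?_)
    · exact measurableSet_tendsto_fun (fun m => (hmf m t i).mono hle le_rfl)
        (measurable_stdNormalCDF_coord t i)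
    · filter_upwards [ae_tendsto_fractionBelow θ] with z hz using hz i _
  have hne : ∀ᵐ p ∂μ, ∀ (i : Fin n) (s t : ℕ), s ≠ t → p.2 s i ≠ p.2 t i := by
    refine (Measure.ae_compProd_iff ?_).2 (ae_of_all _ fun θ => ae_ne_of_ne θ)
    simp only [Set.ofPred_forall]
    refine MeasurableSet.iInter fun i => MeasurableSet.iInter fun s => MeasurableSet.iInter fun t =>
      MeasurableSet.iInter fun _ => ?_
    exact (measurableSet_eq_fun (by fun_prop) (by fun_prop)).compl
  refine ae_all_iff.2 fun t => ae_all_iff.2 fun i => ae_all_iff.2 fun q => ?_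
  set B := {p' : VARParam n × (ℕ → EuclideanSpace ℝ (Fin n)) |
    (q : ℝ) < stdNormalCDF (p'.2 t i)} with hBdef
  have hB : MeasurableSet B := measurableSet_lt measurable_const (measurable_stdNormalCDF_coord t i)
  -- `Φ(z_{t,i})` is almost surely the limit of the relative ranks; the `limsup` provides a version
  -- of the event `B` that is measurable with respect to the ranks of the whole path.
  set L := {p : VARParam n × (ℕ → EuclideanSpace ℝ (Fin n)) |
    (q : ℝ) < limsup (fractionBelow (fun s => p.2 s i) (p.2 t i)) atTop}
  have hL : MeasurableSet[⨆ T, rankFiltration n T] L :=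
    measurableSet_lt measurable_const (Measurable.limsup fun m => hmf m t i)
  have hLB : L.indicator (fun _ => (1 : ℝ)) =ᵐ[μ] B.indicator (fun _ => (1 : ℝ)) := by
    filter_upwards [hfrac] with p hp
    simp only [Set.indicator, L, B, Set.mem_ofPred_eq, (hp i t).limsup_eq]
  have hlevy := Integrable.tendsto_ae_condExp (μ := μ) (ℱ := rankFiltration n)
    ((integrable_const (1 : ℝ)).indicator (hle _ hL))
    ((@stronglyMeasurable_const _ _ (⨆ T, rankFiltration n T) _ _).indicator hL)
  have hpost : ∀ᵐ p ∂μ, ∀ T, (μ[|(fun p => rankPattern T p.2) ⁻¹' {rankPattern T p.2}]).real B =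
      (μ[L.indicator (fun _ => (1 : ℝ)) | rankFiltration n T]) p := by
    refine ae_all_iff.2 fun T => ?_
    exact (condExp_indicator_comap_of_finite
      ((measurable_rankPattern T).comp measurable_snd) hB).trans
      (condExp_congr_ae hLB).symm
  filter_upwards [hne, hLB, hlevy, hpost] with p hp1 hp2 hp3 hp4
  rw [hp2] at hp3
  have h := ENNReal.tendsto_ofReal (hp3.congr fun T => (hp4 T).symm)
  have hev : ∀ T, ENNReal.ofReal
      ((μ[|(fun p => rankPattern T p.2) ⁻¹' {rankPattern T p.2}]).real B) =
      rankPosterior P T (fun t i => p.2 t i) B := by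
    intro T
    rw [ofReal_measureReal, rankPosterior, rankEvent_eq_preimage hp1]
    rfl
  simp only [hev] at h
  convert h using 2
  by_cases hpB : p ∈ B <;> simp [hpB]

end Posterior

/-! ### Continuous margins preserve the ranks -/

theorem IsDistributionFunction.quantile_le_iff {F : ℝ → ℝ} (hF : IsDistributionFunction F)
    (hc : Continuous F) {p : ℝ} (h0 : 0 < p) (h1 : p < 1) {x : ℝ} :
    quantile F p ≤ x ↔ p ≤ F x := by
  obtain ⟨b, hb⟩ := (hF.tendsto_atBot.eventually (gt_mem_nhds h0)).exists
  obtain ⟨a, ha⟩ := (hF.tendsto_atTop.eventually (lt_mem_nhds h1)).exists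
  have hbdd : BddBelow {s | p ≤ F s} := ⟨b, fun s hs => by
    by_contra hlt
    exact absurd (hF.mono (not_le.1 hlt).le) (not_le.2 (hb.trans_le hs))⟩
  have hmem : p ≤ F (quantile F p) :=
    (isClosed_le continuous_const hc).csInf_mem ⟨a, ha.le⟩ hbdd
  exact ⟨fun h => hmem.trans (hF.mono h), fun h => csInf_le hbdd h⟩

theorem IsDistributionFunction.quantile_lt_quantile {F : ℝ → ℝ} (hF : IsDistributionFunction F)
    (hc : Continuous F) {p q : ℝ} (h0 : 0 < p) (hpq : p < q) (h1 : q < 1) :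
    quantile F p < quantile F q := by
  obtain ⟨b, hb⟩ := (hF.tendsto_atBot.eventually (gt_mem_nhds h0)).exists
  obtain ⟨a, ha⟩ := (hF.tendsto_atTop.eventually (lt_mem_nhds (hpq.trans h1))).exists
  obtain ⟨x, hx⟩ := mem_range_of_exists_le_of_exists_ge hc ⟨b, hb.le⟩ ⟨a, ha.le⟩
  refine ((hF.quantile_le_iff hc h0 (hpq.trans h1)).2 hx.ge).trans_lt (not_le.1 fun h => ?_)
  rw [hF.quantile_le_iff hc (h0.trans hpq) h1, hx] at h
  exact h.not_gt hpq

section Margins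

variable {n : ℕ} {F : Fin n → ℝ → ℝ}

theorem strictMono_quantile_stdNormalCDF (hF : ∀ i, IsDistributionFunction (F i))
    (hc : ∀ i, Continuous (F i)) (i : Fin n) :
    StrictMono fun w => quantile (F i) (stdNormalCDF w) := fun _ _ h =>
  (hF i).quantile_lt_quantile (hc i) (stdNormalCDF_pos _) (strictMono_stdNormalCDF h)
    (stdNormalCDF_lt_one _)

theorem copulaLink_lt_iff (hF : ∀ i, IsDistributionFunction (F i))
    (hc : ∀ i, Continuous (F i)) (z : ℕ → EuclideanSpace ℝ (Fin n)) (i : Fin n) (s t : ℕ) :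
    copulaLink F z s i < copulaLink F z t i ↔ z s i < z t i :=
  (strictMono_quantile_stdNormalCDF hF hc i).lt_iff_lt

/-- With continuous margins the latent path is a function of the observed one. By the Lusin–Souslin
theorem almost sure statements then pull back along `copulaLink F` without a measurability check. -/
theorem measurableEmbedding_copulaLink (hF : ∀ i, IsDistributionFunction (F i))
    (hc : ∀ i, Continuous (F i)) : MeasurableEmbedding (copulaLink F) := by
  refine (measurable_copulaLink hF).measurableEmbedding fun z z' h => ?_
  funext t
  ext i
  exact (strictMono_quantile_stdNormalCDF hF hc i).injective (congrFun (congrFun h t) i)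

theorem rankPosterior_copulaLink (hF : ∀ i, IsDistributionFunction (F i))
    (hc : ∀ i, Continuous (F i)) (P : Measure (VARParam n)) (T : ℕ)
    (z : ℕ → EuclideanSpace ℝ (Fin n)) :
    rankPosterior P T (copulaLink F z) = rankPosterior P T (fun t i => z t i) := by
  simp only [rankPosterior, rankEvent, copulaLink_lt_iff hF hc]

theorem measurableSet_rankEvent (T : ℕ) (y : ℕ → Fin n → ℝ) : MeasurableSet (rankEvent T y) := by
  simp only [rankEvent, Set.ofPred_forall]
  refine MeasurableSet.iInter fun i => MeasurableSet.iInter fun s => MeasurableSet.iInter fun _ =>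
    MeasurableSet.iInter fun t => MeasurableSet.iInter fun _ => MeasurableSet.iInter fun _ => ?_
  exact measurableSet_lt (by fun_prop) (by fun_prop)

theorem rankPosterior_inter_rankEvent (P : Measure (VARParam n)) (T : ℕ) (y : ℕ → Fin n → ℝ)
    (C : Set (VARParam n × (ℕ → EuclideanSpace ℝ (Fin n)))) :
    rankPosterior P T y ({p | p.2 ∈ rankEvent T y} ∩ C) = rankPosterior P T y C :=
  cond_inter_self (measurable_snd (measurableSet_rankEvent T y)) C _

/-! ### Consistency of the margin adjustment -/

/-- On the rank event the margin adjustment at `x` lies between the latent values at any two times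
whose observations are separated by `x`. -/
theorem marginAdjustment_mem_Icc {T : ℕ} {y z : ℕ → ℝ} {x : ℝ}
    (hz : ∀ s < T, ∀ t < T, y s < y t → z s < z t) {t₁ t₂ : ℕ} (h₁ : t₁ < T) (h₂ : t₂ < T)
    (hy₁ : y t₁ ≤ x) (hy₂ : x < y t₂) :
    marginAdjustment T y z x ∈ Set.Icc (stdNormalCDF (z t₁)) (stdNormalCDF (z t₂)) := by
  rw [marginAdjustment, if_neg fun h => (h t₁ h₁).not_ge hy₁, if_neg fun h => (h t₂ h₂).not_gt hy₂]
  have hub : ∀ u ∈ {u | ∃ t < T, y t ≤ x ∧ u = stdNormalCDF (z t)}, u ≤ stdNormalCDF (z t₂) := by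
    rintro _ ⟨t, ht, hyt, rfl⟩
    exact (strictMono_stdNormalCDF (hz t ht t₂ h₂ (hyt.trans_lt hy₂))).le
  exact ⟨le_csSup ⟨_, hub⟩ ⟨t₁, h₁, hy₁, rfl⟩, csSup_le ⟨_, t₁, h₁, hy₁, rfl⟩ hub⟩

/-- The deterministic part of the argument, for a fixed latent path `z` whose values are dense in each
series and at which the rank posterior probabilities of the events `{q < Φ(z_{t,i})}` converge to
their indicators. -/
theorem tendsto_marginPosterior (hF : ∀ i, IsDistributionFunction (F i))
    (hc : ∀ i, Continuous (F i)) (P : Measure (VARParam n))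
    {z : ℕ → EuclideanSpace ℝ (Fin n)}
    (hdense : ∀ (i : Fin n) (a b : ℝ), a < b → ∃ s, z s i ∈ Set.Ioo a b)
    (hpost : ∀ (t : ℕ) (i : Fin n) (q : ℚ),
      Tendsto (fun T => rankPosterior P T (fun t i => z t i)
          {p | (q : ℝ) < stdNormalCDF (p.2 t i)}) atTop
        (𝓝 (if (q : ℝ) < stdNormalCDF (z t i) then 1 else 0)))
    (i : Fin n) (x : ℝ) {A : Set ℝ} (hA : A ∈ 𝓝 (F i x)) :
    Tendsto (fun T => marginPosterior P T (copulaLink F z) i x A) atTop (𝓝 1) := by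
  have hle : ∀ t, copulaLink F z t i ≤ x ↔ stdNormalCDF (z t i) ≤ F i x := fun t =>
    (hF i).quantile_le_iff (hc i) (stdNormalCDF_pos _) (stdNormalCDF_lt_one _)
  simp only [← rankPosterior_copulaLink hF hc] at hpost
  set y := copulaLink F z
  have hprob : ∀ T C, rankPosterior P T y C ≤ 1 := fun T C => by
    unfold rankPosterior; exact prob_le_one
  -- The rank posterior is the zero measure if the rank event is null; that this happens for no
  -- large `T` is part of `hpost`, as `{-1 < Φ(z_{0,i})}` is the whole space.
  have huniv : Tendsto (fun T => rankPosterior P T y Set.univ) atTop (𝓝 1) := by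
    have h := hpost 0 i (-1)
    rw [if_pos (by have := stdNormalCDF_pos (z 0 i); push_cast; linarith)] at h
    exact tendsto_of_tendsto_of_tendsto_of_le_of_le h tendsto_const_nhds
      (fun T => measure_mono (Set.subset_univ _)) (fun T => hprob T _)
  have hmem := mem_of_mem_nhds hA
  -- Where `F i` equals `0` or `1` the margin adjustment is exactly `F i x` as soon as `0 < T`.
  rcases le_or_gt (F i x) 0 with h0 | h0
  · have hx : F i x = 0 := le_antisymm h0 ((hF i).mono.le_of_tendsto (hF i).tendsto_atBot x)
    have : ∀ t, x < y t i := fun t => not_le.1 fun h =>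
      ((hle t).1 h).not_gt (h0.trans_lt (stdNormalCDF_pos _))
    refine huniv.congr fun T => ?_
    simp only [marginPosterior, marginAdjustment, this, implies_true, if_true, ← hx, hmem,
      Set.ofPred_true]
  rcases le_or_gt 1 (F i x) with h1 | h1
  · have hx : F i x = 1 := le_antisymm ((hF i).mono.ge_of_tendsto (hF i).tendsto_atTop x) h1
    have : ∀ t, y t i ≤ x := fun t => (hle t).2 ((stdNormalCDF_lt_one _).le.trans h1)
    refine huniv.congr' ?_
    filter_upwards [eventually_gt_atTop 0] with T hT
    have hnot : ¬ ∀ t < T, x < y t i := fun h => (h 0 hT).not_ge (this 0)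
    simp only [marginPosterior, marginAdjustment, hnot, if_false, this, implies_true, if_true,
      ← hx, hmem, Set.ofPred_true]
  obtain ⟨w, hw⟩ := exists_stdNormalCDF_eq h0 h1
  obtain ⟨l, r, ⟨hl, hr⟩, hlr⟩ := mem_nhds_iff_exists_Ioo_subset.1 hA
  have hcw := continuous_stdNormalCDF.continuousAt (x := w)
  obtain ⟨a, haw, ha⟩ := exists_Ioc_subset_of_mem_nhds
    (hcw.eventually (lt_mem_nhds (hl.trans_eq hw.symm))) (exists_lt w)
  obtain ⟨b, hwb, hb⟩ := exists_Ico_subset_of_mem_nhds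
    (hcw.eventually (gt_mem_nhds (hw.trans_lt hr))) (exists_gt w)
  obtain ⟨t₁, ht₁⟩ := hdense i a w haw
  obtain ⟨t₂, ht₂⟩ := hdense i w b hwb
  obtain ⟨q₁, hlq₁, hq₁⟩ := exists_rat_btwn (show l < stdNormalCDF (z t₁ i) from
    ha ⟨ht₁.1, ht₁.2.le⟩)
  obtain ⟨q₂, hq₂, hqr₂⟩ := exists_rat_btwn (show stdNormalCDF (z t₂ i) < r from
    hb ⟨ht₂.1.le, ht₂.2⟩)
  have hy₁ : y t₁ i ≤ x := (hle t₁).2 (hw ▸ (strictMono_stdNormalCDF ht₁.2).le)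
  have hy₂ : x < y t₂ i := not_le.1 fun h =>
    ((hle t₂).1 h).not_gt (hw ▸ strictMono_stdNormalCDF ht₂.1)
  have hlim := ENNReal.Tendsto.sub (hpost t₁ i q₁) (hpost t₂ i q₂) (Or.inr (by split_ifs <;> simp))
  rw [if_pos hq₁, if_neg hq₂.not_gt, tsub_zero] at hlim
  refine tendsto_of_tendsto_of_tendsto_of_le_of_le' hlim tendsto_const_nhds ?_
    (Eventually.of_forall fun T => hprob T _)
  filter_upwards [eventually_gt_atTop t₁, eventually_gt_atTop t₂] with T hT₁ hT₂
  -- The events `{q₁ < Φ(z_{t₁})}` and `{Φ(z_{t₂}) ≤ q₂}` have posterior probability tending to `1`,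
  -- and together with the rank event they place the margin adjustment in `(l, r)`.
  refine le_measure_sdiff.trans ?_
  rw [← rankPosterior_inter_rankEvent, marginPosterior]
  refine measure_mono fun p hp => hlr ?_
  obtain ⟨hp, hp₁, hp₂⟩ := hp
  have h := marginAdjustment_mem_Icc (fun s hs t ht => hp i s hs t ht) hT₁ hT₂ hy₁ hy₂
  exact ⟨hlq₁.trans (lt_of_lt_of_le hp₁ h.1), (h.2.trans (not_lt.1 hp₂)).trans_lt hqr₂⟩

end Margins

theorem theorem3 {n : ℕ}
    (ν P : Measure (VARParam n)) [IsProbabilityMeasure P]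
    (π : VARParam n → ℝ≥0∞) (hπ : Measurable π)
    (hP : P = ν.withDensity π)
    (hpos : ∀ᵐ θ ∂ν, 0 < π θ) :
    ∀ᵐ θ₀ ∂ν, ∀ F : Fin n → ℝ → ℝ,
      (∀ i, IsDistributionFunction (F i)) → (∀ i, Continuous (F i)) →
      ∀ (i : Fin n) (x : ℝ), ∀ A ∈ 𝓝 (F i x),
        ∀ᵐ y ∂(obsLaw θ₀ F),
          Tendsto (fun T : ℕ => marginPosterior P T y i x A) atTop (𝓝 1) := by
  have hνP : ν ≪ P :=
    hP ▸ withDensity_absolutelyContinuous' hπ.aemeasurable (hpos.mono fun _ h => h.ne')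
  filter_upwards [hνP.ae_le (Measure.ae_ae_of_ae_compProd (ae_tendsto_rankPosterior P))]
    with θ₀ hθ₀ F hF hc i x A hA
  rw [obsLaw, (measurableEmbedding_copulaLink hF hc).ae_map_iff]
  filter_upwards [hθ₀, ae_tendsto_fractionBelow θ₀] with z hz hz'
  refine tendsto_marginPosterior hF hc P
    (fun i a b => exists_mem_Ioo_of_tendsto_fractionBelow (hz' i)) (fun t i q => ?_) i x hA
  simpa [Set.indicator] using hz t i q
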